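/- Throughout, for a poset $U$, an \emph{ideal} of $U$ is a nonempty upward directed lower subset. A finite subset $V$ of $U$ is a \emph{kernel} if for every $u\in U$ there is a largest $v\in V$ with $v\le u$; $U$ is \emph{supported} if every finite subset of $U$ is contained in a kernel of $U$. A \emph{norm-covering} of a poset $A$ is a pair $(U,\partial)$ where $U$ is a supported poset and $\partial\colon U\to A$ is isotone. An ideal $\mathbf u$ of $U$ is \emph{sharp} if $\{\partial u : u\in\mathbf u\}$ has a largest element, denoted $\partial\mathbf u$. An \emph{$\aleph_0$-lifter} of $A$ is a pair $(U,\mathbf U)$ where $U$ (with $\partial$) is a norm-covering of $A$ and $\mathbf U$ is a set of sharp ideals of $U$, ordered by inclusion, such that, putting $\mathbf U^{=}=\{\mathbf u\in\mathbf U : \partial\mathbf u\text{ is not maximal in }A\}$: (1) for each $\mathbf u\in\mathbf U^{=}$, the set $\{\mathbf v\in\mathbf U:\mathbf v\subseteq\mathbf u\}$ is finite; (2) for every map $S$ from $\mathbf U^{=}$ to the set of finite subsets of $U$, there is an isotone map $\sigma\colon A\to\mathbf U$ such that $\partial\sigma(a)=a$ for all $a\in A$ and $S(\sigma(a))\cap\sigma(b)\subseteq\sigma(a)$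 for all $a<b$ in $A$. For an integer $m>1$ put $B_m({\le}2)=\{Y\subseteq\{0,\dots,m-1\} : |Y|\le 2\text{ or }Y=\{0,\dots,m-1\}\}$, ordered by inclusion. \textbf{Corollary.} Let $m>1$ be an integer and let $P$ be a join-semilattice with a least element $0$ that is embeddable, as a poset, into $B_m({\le}2)$. Let $X\subseteq P$, let $\vec R=(R_x)_{x\in X}$ be a family of finite sets, and let $1\le\alpha\le\omega$. Let $A$ be the set of all $(n,\vec x,\vec r,p)$ with $n<\alpha$, $\vec x=(x_0,\dots,x_{n-1})\in X^n$, $\vec r\in R_{x_0}\times\dots\times R_{x_{n-1}}$ and $p\in P$, ordered by $(m',\vec x,\vec r,p)\le(n,\vec y,\vec s,q)$ if and only if $m'\le n$, $\vec x=(y_0,\dots,y_{m'-1})$, $\vec r=(s_0,\dots,s_{m'-1})$, $p\le q$ in case $m'=n$, and $p\le y_{m'}$ in case $m'<n$. Then there exists an $\aleph_0$-lifter $(U,\mathbf U)$ of $A$ such that $U$ has cardinality $\aleph_2$. -/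

import Mathlib

universe u v

namespace CritPoint

section Posets

variable {U : Type u} {A : Type v} [PartialOrder U] [PartialOrder A]

/-- A finite subset `V` of a poset `U` is a kernel if every `u : U` has a largest element of `V`
below it. -/
def IsKernel (V : Finset U) : Prop :=
  ∀ u : U, ∃ v : U, IsGreatest {w : U | w ∈ V ∧ w ≤ u} v

variable (U) in
/-- A poset is supported if each of its finite subsets is contained in a kernel. -/
def IsSupported : Prop :=
  ∀ V : Finset U, ∃ W : Finset U, V ⊆ W ∧ IsKernel W

/-- `(U, nu)` is a norm-covering of the poset `A`: `U` is supported and `nu : U → A` is isotone. -/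
structure IsNormCovering (nu : U → A) : Prop where
  supported : IsSupported U
  isotone : Monotone nu

/-- An ideal (nonempty directed lower subset) of `U` is sharp if its image under `nu` has a
largest element. -/
def IsSharp (nu : U → A) (I : Order.Ideal U) : Prop :=
  ∃ a : A, IsGreatest (nu '' (I : Set U)) a

/-- The sharp ideals of `(U, nu)`, ordered by inclusion. -/
abbrev SharpIdeal (nu : U → A) : Type u :=
  {I : Order.Ideal U // IsSharp nu I}

/-- The largest element of the image of a sharp ideal under `nu`. -/
noncomputable def SharpIdeal.norm {nu : U → A} (I : SharpIdeal nu) : A :=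
  I.2.choose

theorem SharpIdeal.isGreatest_norm {nu : U → A} (I : SharpIdeal nu) :
    IsGreatest (nu '' (I.1 : Set U)) I.norm :=
  I.2.choose_spec

theorem SharpIdeal.norm_eq_iff {nu : U → A} (I : SharpIdeal nu) (a : A) :
    I.norm = a ↔ IsGreatest (nu '' (I.1 : Set U)) a :=
  ⟨fun h => h ▸ I.isGreatest_norm, fun h => I.isGreatest_norm.unique h⟩

/-- The members of `B` whose norm is not maximal in `A`. -/
def nonMaxPart {nu : U → A} (B : Set (SharpIdeal nu)) : Set (SharpIdeal nu) :=
  {I | I ∈ B ∧ ¬ IsMax I.norm}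

/-- `((U, nu), B)` is an `ℵ₀`-lifter of the poset `A`. In the last clause, `σ a` automatically
belongs to `nonMaxPart B`, because its norm `a` lies strictly below `b`. -/
structure IsAlephZeroLifter (nu : U → A) (B : Set (SharpIdeal nu)) : Prop where
  isNormCovering : IsNormCovering nu
  lowerFinite : ∀ I ∈ nonMaxPart B, {J : SharpIdeal nu | J ∈ B ∧ J ≤ I}.Finite
  exists_section : ∀ S : nonMaxPart B → Finset U,
    ∃ σ : A → SharpIdeal nu,
      (∀ a, σ a ∈ B) ∧
      Monotone σ ∧
      (∀ a, (σ a).norm = a) ∧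
      ∀ a b, a < b → ∃ h : σ a ∈ nonMaxPart B,
        (S ⟨σ a, h⟩ : Set U) ∩ ((σ b).1 : Set U) ⊆ ((σ a).1 : Set U)

end Posets

/-- The poset of all subsets of `{0, …, m - 1}` that have at most two elements or are the whole
set, ordered by inclusion. -/
abbrev BLeTwo (m : ℕ) : Type :=
  {Y : Finset (Fin m) // Y.card ≤ 2 ∨ Y = Finset.univ}

section TreeLex

variable {P : Type u}

/-- The tree `T` of all triples `(n, x, r)` with `n < α`, `x ∈ X ^ n` and
`r ∈ R (x 0) × ⋯ × R (x (n - 1))`. The pair `(x, r)` is stored as the `n`-tuple of the pairs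
`(x i, r i)`, that is, as an `n`-tuple of elements of the disjoint union of the `R x`. -/
structure Tree (X : Set P) (R : X → Type v) (α : ℕ∞) : Type (max u v) where
  length : ℕ
  length_lt : (length : ℕ∞) < α
  entry : Fin length → Σ x : X, R x

namespace Tree

variable {X : Set P} {R : X → Type v} {α : ℕ∞}

/-- `s ≤ t` if `s` is the restriction of `t` to its first `s.length` entries. -/
instance : LE (Tree X R α) where
  le s t := ∃ h : s.length ≤ t.length, ∀ i : Fin s.length, s.entry i = t.entry (Fin.castLE h i)

instance : PartialOrder (Tree X R α) where
  le_refl s := ⟨le_rfl, fun _ => rfl⟩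
  le_trans s t w := by
    rintro ⟨h, hs⟩ ⟨k, ht⟩
    exact ⟨h.trans k, fun i => (hs i).trans (ht _)⟩
  le_antisymm s t := by
    rintro ⟨h, hs⟩ ⟨k, -⟩
    obtain ⟨m, hm, x⟩ := s
    obtain ⟨n, hn, y⟩ := t
    obtain rfl : m = n := le_antisymm h k
    congr 1
    funext i
    exact hs i

theorem length_le {s t : Tree X R α} (h : s ≤ t) : s.length ≤ t.length := h.1

end Tree

/-- The underlying set `T × P` of the tree-lexicographic poset built from `P`, `X`, `R`, `α`. -/
@[ext]
structure TreeLex (X : Set P) (R : X → Type v) (α : ℕ∞) : Type (max u v) where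
  node : Tree X R α
  val : P

namespace TreeLex

variable [PartialOrder P] {X : Set P} {R : X → Type v} {α : ℕ∞}

/-- Writing `a = (m, x, r, p)` and `b = (n, y, s, q)`: `a ≤ b` if `(m, x, r) ≤ (n, y, s)` in the
tree, `p ≤ q` in case `m = n`, and `p ≤ y m` in case `m < n`. -/
instance : LE (TreeLex X R α) where
  le a b := a.node ≤ b.node ∧
    (a.node.length = b.node.length → a.val ≤ b.val) ∧
    ∀ h : a.node.length < b.node.length, a.val ≤ ((b.node.entry ⟨a.node.length, h⟩).1 : P)

instance : PartialOrder (TreeLex X R α) where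
  le_refl a := ⟨le_rfl, fun _ => le_rfl, fun h => absurd h (lt_irrefl _)⟩
  le_trans a b c := by
    rintro ⟨h1, h2, h3⟩ ⟨k1, k2, k3⟩
    have l1 := Tree.length_le h1
    have l2 := Tree.length_le k1
    refine ⟨h1.trans k1, fun e => (h2 (by omega)).trans (k2 (by omega)), fun h => ?_⟩
    rcases l1.lt_or_eq with l | l
    · have := k1.2 ⟨a.node.length, l⟩
      have h3' := h3 l
      rw [this] at h3'
      exact h3'
    · have hk := k3 (l ▸ h)
      refine (h2 l).trans (hk.trans (le_of_eq ?_))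
      congr 3
      exact Fin.ext l.symm
  le_antisymm a b := by
    rintro ⟨h1, h2, -⟩ ⟨k1, k2, -⟩
    have e : a.node = b.node := le_antisymm h1 k1
    exact TreeLex.ext e (le_antisymm (h2 (by rw [e])) (k2 (by rw [e])))

end TreeLex

end TreeLex

end CritPoint

/-! Write `A` for the tree-lexicographic poset and let `L` be the set of finite subsets of a set `κ`
of size `ℵ₂`. Take `U` to be the finite subsets of `L × A` with bounded projection to `A`, normed by
the join of the projection, and take its principal ideals. A labelling `f : A → L` gives a section
sending `a` to the ideal generated by the graph of `f` on the elements below `a`. The lifter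
condition then says that `f` is free: if `a, c ≤ b` and the finite set attached to the graph below
`a` mentions `(f c, c)`, then `c ≤ a`.

Free labellings come from the Hajnal–Máté theorem `exists_free_set`. It concerns pairs and needs
only `ℵ₂` because a non-top element of `BLeTwo m` has at most two points. `exists_free_labelling`
labels one copy of `P` by images of such points under a free family; `TreeLex.exists_free_labelling`
repeats this node by node up the tree. -/

namespace CritPoint

/-! ### Free sets for finite-valued set mappings on pairs -/

section FreeSets

/-- Recursive choice: if `Φ t f` depends only on `f t` and on the values of `f` at the
predecessors of `t`, and can always be achieved by changing `f t`, then some `f` satisfies all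
`Φ t f`. -/
theorem exists_forall_of_update {T : Type*} {K : Type*} [DecidableEq T] [Nonempty K]
    {r : T → T → Prop} (wf : WellFounded r) (Φ : T → (T → K) → Prop)
    (hcongr : ∀ t f g, (∀ s, r s t → f s = g s) → f t = g t → Φ t f → Φ t g)
    (hstep : ∀ t f, ∃ y, Φ t (Function.update f t y)) : ∃ f, ∀ t, Φ t f := by
  classical
  choose y hy using hstep
  let ext (t : T) (rec : ∀ s, r s t → K) : T → K :=
    fun s => if h : r s t then rec s h else Classical.arbitrary K
  let f : T → K := wf.fix fun t rec => y t (ext t rec)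
  refine ⟨f, fun t => hcongr t _ f ?_ ?_ (hy t (ext t fun s _ => f s))⟩
  · intro s hs
    have hne : s ≠ t := fun h => wf.irrefl.irrefl t (h ▸ hs)
    simp [Function.update_of_ne hne, ext, hs]
  · rw [Function.update_self]
    exact (wf.fix_eq (fun t rec => y t (ext t rec)) t).symm

/-- A set mapping with finite values admits a countable colouring all of whose colour classes
are free. -/
theorem exists_coloring_of_finset_map {S : Type u} (G : S → Finset S) :
    ∃ c : S → ℕ, ∀ v w, w ∈ G v → w ≠ v → c w ≠ c v := by
  classical
  let reach : S → S → Prop := Relation.ReflTransGen fun v w => w ∈ G v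
  have hcount : ∀ w, {v | reach w v}.Countable := by
    intro w
    let L : ℕ → Set S := fun n => Nat.rec {w} (fun _ Z => ⋃ z ∈ Z, (G z : Set S)) n
    have hL : ∀ n, (L n).Countable := by
      intro n
      induction n with
      | zero => exact Set.countable_singleton w
      | succ n ih => exact ih.biUnion fun z _ => (G z).countable_toSet
    refine (Set.countable_iUnion hL).mono fun v hv => ?_
    induction hv with
    | refl => exact Set.mem_iUnion.2 ⟨0, rfl⟩
    | tail _ hbc ih =>
      obtain ⟨n, hn⟩ := Set.mem_iUnion.1 ih
      exact Set.mem_iUnion.2 ⟨n + 1, Set.mem_biUnion hn hbc⟩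
  let lt : S → S → Prop := WellOrderingRel
  have wf : WellFounded lt := IsWellFounded.wf
  -- `ρ v` is the least element reaching `v`. It cannot increase along an edge, and its fibres are
  -- countable.
  let ρ : S → S := fun v => wf.min {w | reach w v} ⟨v, .refl⟩
  have hρ : ∀ v, reach (ρ v) v := fun v => wf.min_mem {w | reach w v} ⟨v, .refl⟩
  have hρ_le : ∀ v w, w ∈ G v → lt (ρ w) (ρ v) ∨ ρ w = ρ v := by
    intro v w hw
    rcases trichotomous_of lt (ρ w) (ρ v) with h | h | h
    · exact .inl h
    · exact .inr h
    · exact absurd h (wf.not_lt_min {z | reach z w} ((hρ v).tail hw))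
  choose i hi using fun w => Set.countable_iff_exists_injOn.1 (hcount w)
  let key : S → S × ℕ := fun v => (ρ v, i (ρ v) v)
  have key_inj : ∀ v w, ρ v = ρ w → i (ρ v) v = i (ρ w) w → v = w := by
    intro v w h h'
    rw [← h] at h'
    exact hi (ρ v) (hρ v) (show reach (ρ v) w from h ▸ hρ w) h'
  let r : S → S → Prop := InvImage (Prod.Lex lt (· < ·)) key
  have wfr : WellFounded r := InvImage.wf key (wf.prod_lex Nat.lt_wfRel.wf)
  -- Each `v` has finitely many earlier neighbours: either `w ∈ G v`, or `v ∈ G w`, which forces `ρ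
  -- w = ρ v` and a smaller index. A greedy colouring therefore always finds a fresh number.
  let N : S → Set S := fun v =>
    {w | r w v ∧ (w ∈ G v ∨ (ρ w = ρ v ∧ i (ρ w) w < i (ρ v) v))}
  have hN : ∀ v, (N v).Finite := by
    intro v
    have h2 : {w | ρ w = ρ v ∧ i (ρ w) w < i (ρ v) v}.Finite := by
      refine Set.Finite.of_injOn (f := fun w => i (ρ w) w) (t := Set.Iio (i (ρ v) v))
        (fun w hw => hw.2) ?_ (Set.finite_Iio _)
      intro w hw w' hw' h
      exact key_inj w w' (hw.1.trans hw'.1.symm) h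
    exact ((G v).finite_toSet.union h2).subset fun w hw => hw.2
  obtain ⟨c, hc⟩ := exists_forall_of_update (K := ℕ) wfr
    (fun v c => ∀ w ∈ N v, c w ≠ c v)
    (by
      intro t f g hs ht h w hw
      rw [← hs w hw.1, ← ht]
      exact h w hw)
    (by
      intro v c
      obtain ⟨y, hy⟩ := ((hN v).image c).exists_notMem
      refine ⟨y, fun w hw h => hy ⟨w, hw, ?_⟩⟩
      have hne : w ≠ v := fun h => wfr.irrefl.irrefl v (h ▸ hw.1)
      simpa [Function.update_of_ne hne] using h)
  refine ⟨c, fun v w hw hne => ?_⟩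
  rcases hρ_le v w hw with h | h
  · exact hc v w ⟨Prod.Lex.left _ _ h, .inl hw⟩
  · rcases lt_trichotomy (i (ρ w) w) (i (ρ v) v) with h' | h' | h'
    · refine hc v w ⟨?_, .inl hw⟩
      exact Prod.lex_def.2 (.inr ⟨h, h'⟩)
    · exact absurd (key_inj w v h h') hne
    · refine (hc w v ⟨?_, .inr ⟨h.symm, h'⟩⟩).symm
      exact Prod.lex_def.2 (.inr ⟨h.symm, h'⟩)

/-- There are well-ordered sets of cardinality at most `ℵ₁` (the finite powers of `ω₁`), with a
countably additive notion of positive set, in which every countable colouring of the pairs has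
an `(n + 1)`-element chain where the colour of a pair depends only on its larger element. -/
theorem exists_wellOrder_chain (n : ℕ) :
    ∃ (Λ : Type u) (_ : LinearOrder Λ) (_ : WellFoundedLT Λ) (Pos : Set Λ → Prop),
      Cardinal.mk Λ ≤ Cardinal.aleph 1 ∧ Pos Set.univ ∧
      (∀ Z, Pos Z → ∀ f : Λ → ℕ, ∃ k, Pos (Z ∩ f ⁻¹' {k})) ∧
      ∀ (c : Λ → Λ → ℕ) (Z : Set Λ), Pos Z → ∃ a : ℕ → Λ,
        (∀ i ≤ n, a i ∈ Z) ∧ (∀ i j, i < j → j ≤ n → a i < a j) ∧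
        ∀ i k j, i < j → k < j → j ≤ n → c (a i) (a j) = c (a k) (a j) := by
  induction n with
  | zero =>
    refine ⟨PUnit, inferInstance, inferInstance, Set.Nonempty, ?_, Set.univ_nonempty, ?_, ?_⟩
    · simpa using (Cardinal.one_lt_aleph0.le.trans (Cardinal.aleph0_le_aleph 1))
    · rintro Z ⟨x, hx⟩ f
      exact ⟨f x, x, hx, rfl⟩
    · rintro c Z ⟨x, hx⟩
      exact ⟨fun _ => x, fun _ _ => hx, fun i j h h' => by omega, fun i k j h _ h' => by omega⟩
  | succ n ih =>
    obtain ⟨Λ, _, _, Pos, hcard, huniv, hadd, hchain⟩ := ih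
    let Ω : Type u := (Cardinal.aleph.{u} 1).ord.ToType
    have hΩ : Cardinal.mk Ω = Cardinal.aleph 1 := Cardinal.mk_ord_toType _
    -- Positive means having uncountably many positive fibres; additivity holds because a countable
    -- union of countable sets is countable.
    refine ⟨Ω ×ₗ Λ, inferInstance, inferInstance,
      fun Z => ¬ {α : Ω | Pos {x | toLex (α, x) ∈ Z}}.Countable, ?_, ?_, ?_, ?_⟩
    · have : Cardinal.mk (Ω ×ₗ Λ) = Cardinal.mk (Ω × Λ) := rfl
      rw [this, Cardinal.mk_prod, Cardinal.lift_id, Cardinal.lift_id, hΩ]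
      exact (mul_le_mul_right hcard _).trans
        (Cardinal.mul_eq_self (Cardinal.aleph0_le_aleph 1)).le
    · have : {α : Ω | Pos {x | toLex (α, x) ∈ (Set.univ : Set (Ω ×ₗ Λ))}} = Set.univ :=
        Set.eq_univ_of_forall fun α => by simpa using huniv
      beta_reduce
      rw [this, Set.countable_univ_iff, ← Cardinal.mk_le_aleph0_iff, hΩ, not_le]
      exact Cardinal.aleph0_lt_aleph_one
    · intro Z hZ f
      by_contra! h
      refine hZ ((Set.countable_iUnion h).mono fun α hα => ?_)
      obtain ⟨k, hk⟩ := hadd _ hα fun x => f (toLex (α, x))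
      exact Set.mem_iUnion.2 ⟨k, hk⟩
    · intro c Z hZ
      have hnt : {α : Ω | Pos {x | toLex (α, x) ∈ Z}}.Nontrivial := by
        by_contra h
        exact hZ (Set.not_nontrivial_iff.1 h).countable
      obtain ⟨α, hα, α', hα', hlt⟩ := hnt.exists_lt
      -- The constant colouring only serves to extract a point `b 0` over `α'`. It tops a chain
      -- found over `α`, inside a positive set of points whose pairs with `b 0` share one colour.
      obtain ⟨b, hb, -⟩ := hchain (fun _ _ => 0) _ hα'
      obtain ⟨k, hk⟩ := hadd _ hα fun x => c (toLex (α, x)) (toLex (α', b 0))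
      obtain ⟨a, ha, ha_lt, hac⟩ :=
        hchain (fun x y => c (toLex (α, x)) (toLex (α, y))) _ hk
      refine ⟨fun i => if i ≤ n then toLex (α, a i) else toLex (α', b 0), ?_, ?_, ?_⟩
      · intro i _
        dsimp only
        split_ifs with h
        · exact (ha i h).1
        · exact hb 0 (Nat.zero_le n)
      · intro i j hij hj
        have hi : i ≤ n := by omega
        by_cases h : j ≤ n
        · simp only [hi, h, if_true]
          exact Prod.Lex.toLex_lt_toLex.2 (.inr ⟨rfl, ha_lt i j hij h⟩)
        · simp only [hi, h, if_true, if_false]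
          exact Prod.Lex.toLex_lt_toLex.2 (.inl hlt)
      · intro i l j hij hlj hj
        have hi : i ≤ n := by omega
        have hl : l ≤ n := by omega
        by_cases h : j ≤ n
        · simp only [hi, hl, h, if_true]
          exact hac i l j hij hlj h
        · simp only [hi, hl, h, if_true, if_false]
          exact (ha i hi).2.trans (ha l hl).2.symm

/-- A family in `κ` indexed by a well-ordered set of cardinality at most `ℵ₁`, none of whose
members is captured by a pair of earlier ones. -/
theorem exists_family_notMem_of_lt {κ Λ : Type u} [LinearOrder Λ] [WellFoundedLT Λ]
    (hΛ : Cardinal.mk Λ ≤ Cardinal.aleph 1) (hκ : Cardinal.aleph 2 ≤ Cardinal.mk κ)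
    (G : κ → κ → Finset κ) :
    ∃ h : Λ → κ, ∀ a b c, a < c → b < c → h c ∉ G (h a) (h b) := by
  classical
  have h12 : Cardinal.aleph.{u} 1 < Cardinal.aleph 2 := Cardinal.aleph_lt_aleph.2 (by norm_num)
  have : Nonempty κ := Cardinal.mk_ne_zero_iff.1
    ((zero_le.trans_lt h12).trans_le hκ).ne'
  obtain ⟨h, hh⟩ := exists_forall_of_update (K := κ) (r := ((· < ·) : Λ → Λ → Prop)) wellFounded_lt
    (fun c h => ∀ a b, a < c → b < c → h c ∉ G (h a) (h b))
    (by
      intro t f g hs ht h a b ha hb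
      rw [← hs a ha, ← hs b hb, ← ht]
      exact h a b ha hb)
    (by
      intro c h
      -- `Λ` has at most `ℵ₁` pairs, each forbidding finitely many values.
      have hlt : Cardinal.mk (⋃ p : Λ × Λ, (G (h p.1) (h p.2) : Set κ)) < Cardinal.mk κ := by
        refine ((Cardinal.mk_iUnion_le _).trans ?_).trans_lt (h12.trans_le hκ)
        refine (mul_le_mul' (b := Cardinal.aleph 1) (d := Cardinal.aleph 1) ?_ ?_).trans
          (Cardinal.mul_eq_self (Cardinal.aleph0_le_aleph 1)).le
        · rw [Cardinal.mk_prod, Cardinal.lift_id]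
          exact (mul_le_mul' hΛ hΛ).trans
            (Cardinal.mul_eq_self (Cardinal.aleph0_le_aleph 1)).le
        · refine ciSup_le' fun p => ?_
          exact (Cardinal.mk_lt_aleph0_iff.2 (Finset.finite_toSet _)).le.trans
            (Cardinal.aleph0_le_aleph 1)
      obtain ⟨y, hy⟩ : ∃ y, y ∉ ⋃ p : Λ × Λ, (G (h p.1) (h p.2) : Set κ) := by
        by_contra! hall
        rw [Set.eq_univ_of_forall hall, Cardinal.mk_univ] at hlt
        exact lt_irrefl _ hlt
      refine ⟨y, fun a b ha hb hmem => hy (Set.mem_iUnion.2 ⟨(a, b), ?_⟩)⟩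
      simpa [Function.update_of_ne ha.ne, Function.update_of_ne hb.ne] using hmem)
  exact ⟨h, fun a b c => hh c a b⟩

/-- The Hajnal–Máté theorem: a finite-valued set mapping on the pairs of a set of cardinality at
least `ℵ₂` has finite free sets of every size. -/
theorem exists_free_set {κ : Type u} (hκ : Cardinal.aleph 2 ≤ Cardinal.mk κ)
    (F : κ → κ → Finset κ) (m : ℕ) :
    ∃ h : Fin m → κ, Function.Injective h ∧ ∀ i j k, h k ∈ F (h i) (h j) → k = i ∨ k = j := by
  classical
  -- The singleton makes `h` injective; the other terms cover both orders of a pair and the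
  -- diagonal.
  let G : κ → κ → Finset κ := fun x y => {x} ∪ F x y ∪ F y x ∪ F y y ∪ F x x
  obtain ⟨Λ, _, _, Pos, hcard, huniv, -, hchain⟩ := exists_wellOrder_chain.{u} m
  obtain ⟨h, hh⟩ := exists_family_notMem_of_lt hcard hκ G
  have h_inj : Function.Injective h := by
    refine Function.Injective.of_lt_imp_ne fun a b hab he => hh a a b hab hab ?_
    simp [G, he]
  -- For fixed `b` the colour classes are free for `a ↦ G (h a) (h b)`. In the chain below, all
  -- elements before `a j` share a class for `b = a j`; points above both arguments are already
  -- excluded by `hh`.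
  choose c hc using fun b => exists_coloring_of_finset_map fun a =>
    (G (h a) (h b)).preimage h h_inj.injOn
  obtain ⟨a, -, ha, hac⟩ := hchain (fun x y => c y x) Set.univ huniv
  have ha_inj : ∀ i j, i ≤ m → j ≤ m → a i = a j → i = j := by
    intro i j hi hj he
    rcases lt_trichotomy i j with hij | hij | hij
    · exact absurd he (ha i j hij hj).ne
    · exact hij
    · exact absurd he (ha j i hij hi).ne'
  have key : ∀ i j k, i < j → k < j → j ≤ m → k ≠ i → h (a k) ∉ G (h (a i)) (h (a j)) := by
    intro i j k hij hkj hj hki hmem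
    refine hc (a j) (a i) (a k) (by simpa using hmem) ?_ (hac k i j hkj hij hj)
    exact fun he => hki (ha_inj k i (by omega) (by omega) he)
  -- `a 0` is held back as a partner for the diagonal: when `i = j` and `k < i`, the set `F y y` is
  -- handled as part of `G x y` with `x = h (a 0)`.
  refine ⟨fun i => h (a (i + 1)), fun i j hij => ?_, fun i j k hk => ?_⟩
  · have := ha_inj _ _ (by omega) (by omega) (h_inj hij)
    exact Fin.ext (by omega)
  · by_contra! hne
    have hki : (k : ℕ) ≠ i := fun e => hne.1 (Fin.ext e)
    have hkj : (k : ℕ) ≠ j := fun e => hne.2 (Fin.ext e)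
    have hi := i.2
    have hj := j.2
    have hk' := k.2
    rcases lt_trichotomy (i : ℕ) j with hij | hij | hij
    · rcases hkj.lt_or_gt with hlt | hgt
      · exact key (i + 1) (j + 1) (k + 1) (by omega) (by omega) (by omega) (by omega)
          (by simp [G, hk])
      · exact hh (a (i + 1)) (a (j + 1)) (a (k + 1)) (ha _ _ (by omega) (by omega))
          (ha _ _ (by omega) (by omega)) (by simp [G, hk])
    · obtain rfl : i = j := Fin.ext hij
      rcases hkj.lt_or_gt with hlt | hgt
      · exact key 0 (i + 1) (k + 1) (by omega) (by omega) (by omega) (by omega)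
          (by simp [G, hk])
      · exact hh (a (i + 1)) (a (i + 1)) (a (k + 1)) (ha _ _ (by omega) (by omega))
          (ha _ _ (by omega) (by omega)) (by simp [G, hk])
    · rcases hki.lt_or_gt with hlt | hgt
      · exact key (j + 1) (i + 1) (k + 1) (by omega) (by omega) (by omega) (by omega)
          (by simp [G, hk])
      · exact hh (a (i + 1)) (a (j + 1)) (a (k + 1)) (ha _ _ (by omega) (by omega))
          (ha _ _ (by omega) (by omega)) (by simp [G, hk])

end FreeSets

/-! ### Order structure of the tree and of the tree-lexicographic poset -/

namespace Tree

variable {P : Type u} {X : Set P} {R : X → Type v} {α : ℕ∞}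

theorem eq_of_le_of_length_eq {s t : Tree X R α} (h : s ≤ t) (e : s.length = t.length) :
    s = t :=
  le_antisymm h ⟨e.ge, fun i => by rw [h.2]; rfl⟩

theorem le_or_le_of_le {s t w : Tree X R α} (hs : s ≤ w) (ht : t ≤ w) : s ≤ t ∨ t ≤ s := by
  rcases le_total s.length t.length with h | h
  · exact .inl ⟨h, fun i => by rw [hs.2, ht.2]; rfl⟩
  · exact .inr ⟨h, fun i => by rw [hs.2, ht.2]; rfl⟩

theorem finite_Iic (t : Tree X R α) : (Set.Iic t).Finite := by
  refine Set.Finite.of_injOn (f := length) (t := Set.Iic t.length)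
    (fun s hs => length_le hs) ?_ (Set.finite_Iic _)
  intro s hs w hw e
  rcases le_or_le_of_le hs hw with h | h
  · exact eq_of_le_of_length_eq h e
  · exact (eq_of_le_of_length_eq h e.symm).symm

instance countable [Countable P] [∀ x, Countable (R x)] : Countable (Tree X R α) := by
  refine Function.Injective.countable
    (f := fun t => (⟨t.length, t.entry⟩ : Σ n, Fin n → Σ x : X, R x)) ?_
  rintro ⟨m, hm, x⟩ ⟨n, hn, y⟩ h
  cases h
  rfl

end Tree

namespace TreeLex

section

variable {P : Type u} {X : Set P} {R : X → Type v} {α : ℕ∞}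

theorem finite_node_le [Finite P] (t : Tree X R α) :
    {a : TreeLex X R α | a.node ≤ t}.Finite := by
  refine Set.Finite.of_injOn (f := fun a => (a.node, a.val)) (t := Set.Iic t ×ˢ Set.univ)
    (fun a ha => ⟨ha, trivial⟩) ?_ (t.finite_Iic.prod Set.finite_univ)
  intro a _ b _ h
  exact TreeLex.ext (congrArg Prod.fst h) (congrArg Prod.snd h)

instance countable [Countable P] [∀ x, Countable (R x)] : Countable (TreeLex X R α) :=
  Function.Injective.countable (f := fun a => (a.node, a.val)) fun _ _ h =>
    TreeLex.ext (congrArg Prod.fst h) (congrArg Prod.snd h)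

end

section

variable {P : Type u} [PartialOrder P] {X : Set P} {R : X → Type v} {α : ℕ∞}

theorem mk_le_mk {t : Tree X R α} {p q : P} :
    (⟨t, p⟩ : TreeLex X R α) ≤ ⟨t, q⟩ ↔ p ≤ q :=
  ⟨fun h => h.2.1 rfl, fun h => ⟨le_rfl, fun _ => h, fun h' => absurd h' (lt_irrefl _)⟩⟩

theorem finite_Iic [Finite P] (a : TreeLex X R α) : (Set.Iic a).Finite :=
  (finite_node_le a.node).subset fun _ h => h.1

/-- Whether `a` lies below an element of a strictly later node depends only on that node, and
is decided at any intermediate node. -/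
theorem le_of_le_of_node_le {a b c : TreeLex X R α} (hab : a ≤ b) (hcb : c.node ≤ b.node)
    (h : a.node.length < c.node.length) : a ≤ c := by
  have hac : a.node ≤ c.node := by
    rcases Tree.le_or_le_of_le hab.1 hcb with h' | h'
    · exact h'
    · exact absurd (Tree.length_le h') (by omega)
  refine ⟨hac, fun e => absurd e h.ne, fun h' => ?_⟩
  have := hcb.2 ⟨a.node.length, h'⟩
  rw [this]
  exact hab.2.2 (h.trans_le (Tree.length_le hcb))

end

section

variable {P : Type u} [SemilatticeSup P] {X : Set P} {R : X → Type v} {α : ℕ∞}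

/-- The nodes of `a` and `b` are comparable, being below that of `c`. If they differ, the element at
the shorter node is already below the other; if they agree, the join is taken in `P`. -/
theorem exists_isLUB_pair {a b c : TreeLex X R α} (ha : a ≤ c) (hb : b ≤ c) :
    ∃ d, IsLUB {a, b} d := by
  rcases lt_trichotomy a.node.length b.node.length with h | h | h
  · have hab := le_of_le_of_node_le ha hb.1 h
    refine ⟨b, ?_, fun d hd => hd (by simp)⟩
    rintro x (rfl | rfl)
    exacts [hab, le_rfl]
  · obtain ⟨t, p⟩ := a
    obtain ⟨t', q⟩ := b
    obtain rfl : t = t' := by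
      rcases Tree.le_or_le_of_le ha.1 hb.1 with h' | h'
      · exact Tree.eq_of_le_of_length_eq h' h
      · exact (Tree.eq_of_le_of_length_eq h' h.symm).symm
    refine ⟨⟨t, p ⊔ q⟩, ?_, fun d hd => ?_⟩
    · rintro x (rfl | rfl)
      exacts [mk_le_mk.2 le_sup_left, mk_le_mk.2 le_sup_right]
    · have h1 := hd (Set.mem_insert _ _)
      have h2 := hd (Set.mem_insert_of_mem _ rfl)
      exact ⟨h1.1, fun e => sup_le (h1.2.1 e) (h2.2.1 e), fun e => sup_le (h1.2.2 e) (h2.2.2 e)⟩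
  · have hba := le_of_le_of_node_le hb ha.1 h
    refine ⟨a, ?_, fun d hd => hd (by simp)⟩
    rintro x (rfl | rfl)
    exacts [le_rfl, hba]

variable [OrderBot P]

theorem exists_isBot (hα : 0 < α) : ∃ a : TreeLex X R α, IsBot a := by
  refine ⟨⟨⟨0, by simpa using hα, Fin.elim0⟩, ⊥⟩, fun b => ⟨⟨Nat.zero_le _, fun i => i.elim0⟩,
    fun _ => bot_le, fun _ => bot_le⟩⟩

theorem exists_isLUB_of_bddAbove (hα : 0 < α) {Z : Set (TreeLex X R α)} (hZ : Z.Finite)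
    (hb : BddAbove Z) : ∃ d, IsLUB Z d := by
  induction Z, hZ using Set.Finite.induction_on with
  | empty => exact (exists_isBot hα).imp fun a ha => isLUB_empty_iff.2 ha
  | @insert a Z _ _ ih =>
    obtain ⟨c, hc⟩ := hb
    obtain ⟨w, hw⟩ := ih ⟨c, fun x hx => hc (Set.mem_insert_of_mem _ hx)⟩
    obtain ⟨d, hd⟩ := exists_isLUB_pair (hc (Set.mem_insert _ _))
      (hw.2 fun x hx => hc (Set.mem_insert_of_mem _ hx))
    refine ⟨d, ?_, fun x hx => hd.2 ?_⟩
    · rintro x (rfl | hx)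
      · exact hd.1 (by simp)
      · exact (hw.1 hx).trans (hd.1 (by simp))
    · rintro y (rfl | rfl)
      · exact hx (Set.mem_insert _ _)
      · exact hw.2 fun z hz => hx (Set.mem_insert_of_mem _ hz)

end

end TreeLex

/-! ### Free labellings -/

section FreeLabelling

/-- The graph of the restriction of `f` to the elements below `a`. -/
noncomputable def lowerGraph {A K : Type*} [PartialOrder A] (hA : ∀ a : A, (Set.Iic a).Finite)
    (f : A → K) (a : A) : Finset (K × A) :=
  (hA a).toFinset.map ⟨fun b => (f b, b), fun _ _ h => congrArg Prod.snd h⟩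

theorem mem_lowerGraph {A K : Type*} [PartialOrder A] {hA : ∀ a : A, (Set.Iic a).Finite}
    {f : A → K} {a : A} {z : K × A} : z ∈ lowerGraph hA f a ↔ z.2 ≤ a ∧ z.1 = f z.2 := by
  simp only [lowerGraph, Finset.mem_map, Set.Finite.mem_toFinset, Set.mem_Iic]
  constructor
  · rintro ⟨b, hb, rfl⟩
    exact ⟨hb, rfl⟩
  · rintro ⟨hb, h⟩
    exact ⟨z.2, hb, Prod.ext h.symm rfl⟩

theorem lowerGraph_congr {A K : Type*} [PartialOrder A] {hA : ∀ a : A, (Set.Iic a).Finite}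
    {f g : A → K} {a : A} (h : ∀ b ≤ a, f b = g b) : lowerGraph hA f a = lowerGraph hA g a := by
  ext z
  rw [mem_lowerGraph, mem_lowerGraph]
  exact and_congr_right fun hz => by rw [h _ hz]

/-- A finite-valued set mapping on the finite subsets of `Finset κ × P`, where `P` embeds into
`BLeTwo m`, has a free labelling of `P`, which can avoid any given finite set of labels. -/
theorem exists_free_labelling {κ : Type u} (hκ : Cardinal.aleph 2 ≤ Cardinal.mk κ)
    {P : Type v} [PartialOrder P] [Finite P] {m : ℕ} (e : P ↪o BLeTwo m)
    (F : Finset (Finset κ × P) → Finset (Finset κ)) (E : Finset (Finset κ)) :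
    ∃ φ : P → Finset κ,
      (∀ p q, φ q ∈ F (lowerGraph (fun _ => Set.toFinite _) φ p) → q ≤ p) ∧ ∀ q, φ q ∉ E := by
  classical
  have := Fintype.ofFinite P
  have : Infinite κ := Cardinal.infinite_iff.2 ((Cardinal.aleph0_le_aleph 2).trans hκ)
  -- `k₀` lies in no member of `E`; putting it into every label keeps the labels out of `E`.
  obtain ⟨k₀, hk₀⟩ := Infinite.exists_notMem_finset (E.biUnion id)
  let G : Finset κ → Finset κ := fun W =>
    ((W.powerset ×ˢ (Finset.univ : Finset P)).powerset.biUnion F).biUnion id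
  -- The extra index `Fin.last m` is used by no label; it stands in for the pair `a, b` when `e p`
  -- is empty.
  obtain ⟨h, h_inj, hh⟩ := exists_free_set hκ (fun x y => G {k₀, x, y}) (m + 1)
  let φ : P → Finset κ := fun q => insert k₀ ((e q).1.image fun i => h i.castSucc)
  refine ⟨φ, fun p q hq => ?_, fun q hq => hk₀ ?_⟩
  · rw [← e.le_iff_le]
    intro i hi
    by_contra hip
    have hcard : (e p).1.card ≤ 2 :=
      (e p).2.resolve_right fun hu => hip (by rw [hu]; exact Finset.mem_univ i)
    obtain ⟨a, b, hab, hia, hib⟩ : ∃ a b : Fin (m + 1),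
        (∀ j ∈ (e p).1, j.castSucc = a ∨ j.castSucc = b) ∧ i.castSucc ≠ a ∧ i.castSucc ≠ b := by
      have hne : ∀ j ∈ (e p).1, i.castSucc ≠ j.castSucc := fun j hj hij =>
        hip (Fin.castSucc_injective _ hij ▸ hj)
      rcases Nat.lt_or_ge (e p).1.card 1 with h0 | h1
      · have h0 := Finset.card_eq_zero.1 (Nat.lt_one_iff.1 h0)
        exact ⟨Fin.last m, Fin.last m, by simp [h0], (Fin.castSucc_lt_last i).ne,
          (Fin.castSucc_lt_last i).ne⟩
      · rcases Nat.lt_or_ge (e p).1.card 2 with h1' | h2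
        · obtain ⟨x, hx⟩ := Finset.card_eq_one.1 (by omega : (e p).1.card = 1)
          exact ⟨x.castSucc, x.castSucc, by simp [hx], hne x (by simp [hx]), hne x (by simp [hx])⟩
        · obtain ⟨x, y, -, hxy⟩ := Finset.card_eq_two.1 (by omega : (e p).1.card = 2)
          exact ⟨x.castSucc, y.castSucc, by simp [hxy], hne x (by simp [hxy]),
            hne y (by simp [hxy])⟩
    -- All labels of elements below `p` are contained in `{k₀, h a, h b}`, so the lower graph is one
    -- of the finitely many sets that `G` takes into account.
    have hmem : h i.castSucc ∈ G {k₀, h a, h b} := by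
      refine Finset.mem_biUnion.2 ⟨φ q, Finset.mem_biUnion.2 ⟨_, ?_, hq⟩,
        Finset.mem_insert_of_mem (Finset.mem_image_of_mem _ hi)⟩
      refine Finset.mem_powerset.2 fun z hz => ?_
      obtain ⟨hz1, hz2⟩ := mem_lowerGraph.1 hz
      refine Finset.mem_product.2 ⟨Finset.mem_powerset.2 ?_, Finset.mem_univ _⟩
      rw [hz2]
      refine Finset.insert_subset (by simp) fun x hx => ?_
      obtain ⟨j, hj, rfl⟩ := Finset.mem_image.1 hx
      rcases hab j (e.monotone hz1 hj) with hja | hjb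
      · simp [hja]
      · simp [hjb]
    rcases hh a b i.castSucc hmem with h' | h'
    exacts [hia h', hib h']
  · exact Finset.mem_biUnion.2 ⟨φ q, hq, Finset.mem_insert_self _ _⟩

variable {P : Type u} [SemilatticeSup P] [OrderBot P] {X : Set P} {R : X → Type v} {α : ℕ∞}

/-- The tree-lexicographic poset has free labellings for all finite-valued set mappings. -/
theorem TreeLex.exists_free_labelling [Finite P] {κ : Type*}
    (hκ : Cardinal.aleph 2 ≤ Cardinal.mk κ) {m : ℕ} (e : P ↪o BLeTwo m)
    (F : Finset (Finset κ × TreeLex X R α) → Finset (Finset κ × TreeLex X R α)) :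
    ∃ f : TreeLex X R α → Finset κ, ∀ a b c : TreeLex X R α, a ≤ b → c ≤ b →
      (f c, c) ∈ F (lowerGraph finite_Iic f a) → c ≤ a := by
  classical
  let gr (φ : Tree X R α → P → Finset κ) : TreeLex X R α → Finset (Finset κ × TreeLex X R α) :=
    lowerGraph finite_Iic fun a => φ a.node a.val
  have gr_congr : ∀ (t : Tree X R α) (φ ψ : Tree X R α → P → Finset κ),
      (∀ s : Tree X R α, s.length < t.length → φ s = ψ s) → φ t = ψ t →
      ∀ a : TreeLex X R α, a.node ≤ t → gr φ a = gr ψ a := by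
    intro t φ ψ hlt ht a ha
    refine lowerGraph_congr fun b hb => ?_
    have hbt := hb.1.trans ha
    rcases (Tree.length_le hbt).lt_or_eq with h | h
    · rw [hlt _ h]
    · rw [Tree.eq_of_le_of_length_eq hbt h, ht]
  obtain ⟨φ, hφ⟩ := exists_forall_of_update (T := Tree X R α) (K := P → Finset κ)
    (r := InvImage (· < ·) Tree.length) (InvImage.wf _ Nat.lt_wfRel.wf)
    (fun t φ => (∀ p q, (φ t q, ⟨t, q⟩) ∈ F (gr φ ⟨t, p⟩) → q ≤ p) ∧
      ∀ a : TreeLex X R α, a.node ≤ t → a.node.length < t.length →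
        ∀ q, (φ t q, ⟨t, q⟩) ∉ F (gr φ a))
    (by
      rintro t φ ψ hlt ht ⟨h1, h2⟩
      rw [← ht]
      refine ⟨fun p q => ?_, fun a ha ha' q => ?_⟩
      · rw [← gr_congr t φ ψ hlt ht _ le_rfl]
        exact h1 p q
      · rw [← gr_congr t φ ψ hlt ht _ ha]
        exact h2 a ha ha' q)
    (by
      intro t φ
      -- The earlier part of the lower graph of `⟨t, p⟩` does not depend on `p`, so it is a fixed
      -- parameter while the whole fibre over `t` is labelled at once.
      let J := (gr φ ⟨t, ⊥⟩).filter fun z => z.2.node ≠ t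
      -- New labels avoid everything `F` produces from earlier nodes. Elements at `t` itself also
      -- enter, with their old labels, which only enlarges `E`.
      let E := ((TreeLex.finite_node_le t).toFinset.biUnion fun a => F (gr φ a)).image Prod.fst
      obtain ⟨y, hy, hyE⟩ := CritPoint.exists_free_labelling hκ e
        (fun z => (F (J ∪ z.image fun w => (w.1, ⟨t, w.2⟩))).image Prod.fst) E
      have hgr : ∀ p, gr (Function.update φ t y) ⟨t, p⟩ =
          J ∪ (lowerGraph (fun _ => Set.toFinite _) y p).image fun w => (w.1, ⟨t, w.2⟩) := by
        rintro p
        ext ⟨k, s, q⟩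
        simp only [gr, J, Finset.mem_union, Finset.mem_filter, Finset.mem_image, mem_lowerGraph]
        by_cases hst : s = t
        · subst hst
          simp only [TreeLex.mk_le_mk, Function.update_self, ne_eq, not_true, and_false, false_or]
          constructor
          · rintro ⟨hqp, hk⟩
            exact ⟨(k, q), ⟨hqp, hk⟩, rfl⟩
          · rintro ⟨w, hw, hwe⟩
            cases hwe
            exact hw
        · simp only [Function.update_of_ne hst]
          constructor
          · rintro ⟨hle, hk⟩
            have hlen : s.length < t.length := (Tree.length_le hle.1).lt_of_ne fun h =>
              hst (Tree.eq_of_le_of_length_eq hle.1 h)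
            exact .inl ⟨⟨TreeLex.le_of_le_of_node_le hle le_rfl hlen, hk⟩, hst⟩
          · rintro (⟨⟨hle, hk⟩, -⟩ | ⟨w, -, hwe⟩)
            · exact ⟨hle.trans (TreeLex.mk_le_mk.2 bot_le), hk⟩
            · exact absurd (congrArg (fun z => z.2.node) hwe).symm hst
      refine ⟨y, fun p q hq => hy p q ?_, fun a ha ha' q hq => hyE q ?_⟩
      · rw [Function.update_self, hgr] at hq
        exact Finset.mem_image_of_mem Prod.fst hq
      · rw [Function.update_self, ← gr_congr a.node φ (Function.update φ t y)
          (fun s hs => (Function.update_of_ne (fun h => by subst h; omega) _ _).symm)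
          (Function.update_of_ne (fun h => by rw [h] at ha'; omega) _ _).symm a le_rfl] at hq
        have hmem := (Finset.mem_biUnion (t := fun a => F (gr φ a))).2
          ⟨a, (TreeLex.finite_node_le t).mem_toFinset.2 ha, hq⟩
        exact Finset.mem_image_of_mem Prod.fst hmem)
  refine ⟨fun a => φ a.node a.val, fun a b c hab hcb hmem => ?_⟩
  change _ ∈ F (gr φ a) at hmem
  -- Both nodes lie below that of `b`, hence are comparable. A shorter `c` is below `a` by the order
  -- itself; equal nodes use the first clause of `hφ`, and a longer `c` contradicts the second.
  rcases lt_trichotomy c.node.length a.node.length with h | h | h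
  · exact TreeLex.le_of_le_of_node_le hcb hab.1 h
  · obtain ⟨t, p⟩ := a
    obtain ⟨t', q⟩ := c
    obtain rfl : t' = t := by
      rcases Tree.le_or_le_of_le hcb.1 hab.1 with h' | h'
      · exact Tree.eq_of_le_of_length_eq h' h
      · exact (Tree.eq_of_le_of_length_eq h' h.symm).symm
    exact TreeLex.mk_le_mk.2 ((hφ t').1 p q hmem)
  · refine absurd hmem ((hφ c.node).2 a ?_ h c.val)
    rcases Tree.le_or_le_of_le hab.1 hcb.1 with h' | h'
    · exact h'
    · exact absurd (Tree.length_le h') (by omega)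

end FreeLabelling

/-! ### The lifter of labelled finite sets -/

section LabelledSets

variable {L : Type u} {A : Type v} [PartialOrder A]

variable (L A) in
/-- The finite subsets of `L × A` whose projection to `A` is bounded above, ordered by
inclusion. -/
abbrev BoundedFinset : Type (max u v) :=
  {z : Finset (L × A) // BddAbove (Prod.snd '' (z : Set (L × A)))}

/-- The members contained in a fixed finite set `Y` form a kernel, the largest one below `w` being
`w ∩ Y`, which stays bounded. -/
theorem isSupported_boundedFinset : IsSupported (BoundedFinset L A) := by
  classical
  intro V
  let Y : Finset (L × A) := V.biUnion Subtype.val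
  have hinj : Set.InjOn (Subtype.val : BoundedFinset L A → Finset (L × A))
      (Subtype.val ⁻¹' (Y.powerset : Set (Finset (L × A)))) := Subtype.val_injective.injOn
  have hmem : ∀ w, w ∈ Y.powerset.preimage Subtype.val hinj ↔ w.1 ⊆ Y := fun w => by simp
  refine ⟨Y.powerset.preimage Subtype.val hinj, fun w hw => (hmem w).2 ?_, fun w => ?_⟩
  · exact Finset.subset_biUnion_of_mem Subtype.val hw
  · refine ⟨⟨w.1 ∩ Y, w.2.mono (Set.image_mono (by simp))⟩,
      ⟨(hmem _).2 Finset.inter_subset_right, ?_⟩, fun x hx => ?_⟩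
    · exact Finset.inter_subset_left (s₁ := w.1)
    · exact Finset.subset_inter hx.2 ((hmem x).1 hx.1)

theorem mk_boundedFinset [Infinite L] [Countable A] [Nonempty A] :
    Cardinal.mk (BoundedFinset L A) = Cardinal.lift.{v} (Cardinal.mk L) := by
  have hL : Cardinal.aleph0 ≤ Cardinal.lift.{v} (Cardinal.mk L) := by simp
  refine le_antisymm ?_ ?_
  · refine (Cardinal.mk_subtype_le _).trans ?_
    rw [Cardinal.mk_finset_of_infinite, Cardinal.mk_prod]
    refine (mul_le_mul_right ?_ _).trans (Cardinal.mul_eq_self hL).le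
    exact (Cardinal.lift_le_aleph0.2 (Cardinal.mk_le_aleph0)).trans hL
  · obtain ⟨a⟩ := ‹Nonempty A›
    have hinj : Function.Injective (fun k => ⟨{(k, a)}, a, by simp [upperBounds]⟩ :
        L → BoundedFinset L A) := fun k l h => by
      simpa using congrArg Subtype.val h
    have := Cardinal.lift_mk_le_lift_mk_of_injective hinj
    rwa [Cardinal.lift_umax.{u, v}, Cardinal.lift_id'.{u, v}] at this

/-- The principal ideals of `BoundedFinset L A` form a lifter as soon as `A` is lower finite, has
joins of bounded finite sets, and has free labellings by `L` for all finite-valued set mappings. -/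
theorem exists_isAlephZeroLifter (hA : ∀ a : A, (Set.Iic a).Finite)
    (hlub : ∀ Z : Set A, Z.Finite → BddAbove Z → ∃ d, IsLUB Z d)
    (hfree : ∀ F : Finset (L × A) → Finset (L × A), ∃ f : A → L, ∀ a b c : A, a ≤ b → c ≤ b →
      (f c, c) ∈ F (lowerGraph hA f a) → c ≤ a) :
    ∃ (nu : BoundedFinset L A → A) (B : Set (SharpIdeal nu)), IsAlephZeroLifter nu B := by
  classical
  choose nu hnu using fun z : BoundedFinset L A => hlub _ (z.1.finite_toSet.image Prod.snd) z.2
  have nu_mono : Monotone nu := fun z w h => (hnu z).mono (hnu w) (Set.image_mono h)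
  have greatest : ∀ z, IsGreatest (nu '' (Order.Ideal.principal z : Set _)) (nu z) := fun z =>
    ⟨⟨z, Order.Ideal.mem_principal_self, rfl⟩, by
      rintro _ ⟨w, hw, rfl⟩
      exact nu_mono hw⟩
  let I : BoundedFinset L A → SharpIdeal nu := fun z =>
    ⟨Order.Ideal.principal z, nu z, greatest z⟩
  have hI : ∀ z w, w ∈ (I z).1 ↔ w ≤ z := fun z w => Iff.rfl
  have I_le : ∀ z w, I z ≤ I w ↔ z ≤ w := fun z w => Order.Ideal.principal_le_iff
  have I_norm : ∀ z, (I z).norm = nu z := fun z => (SharpIdeal.norm_eq_iff _ _).2 (greatest z)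
  refine ⟨nu, Set.range I, ⟨isSupported_boundedFinset, nu_mono⟩, ?_, fun S => ?_⟩
  · rintro _ ⟨⟨z, rfl⟩, -⟩
    have hfin : {w : BoundedFinset L A | w ≤ z}.Finite :=
      Set.Finite.of_injOn (f := Subtype.val) (t := (z.1.powerset : Set (Finset (L × A))))
        (fun w hw => Finset.mem_coe.2 (Finset.mem_powerset.2 hw)) Subtype.val_injective.injOn
        (Finset.finite_toSet _)
    refine (hfin.image I).subset ?_
    rintro _ ⟨⟨w, rfl⟩, hw⟩
    exact ⟨w, (I_le w z).1 hw, rfl⟩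
  · obtain ⟨f, hf⟩ := hfree fun z =>
      if h : ∃ hz : BddAbove (Prod.snd '' (z : Set (L × A))), I ⟨z, hz⟩ ∈ nonMaxPart (Set.range I)
      then (S ⟨_, h.choose_spec⟩).biUnion Subtype.val else ∅
    let g : A → BoundedFinset L A := fun a => ⟨lowerGraph hA f a, a, by
      rintro _ ⟨z, hz, rfl⟩
      exact (mem_lowerGraph.1 hz).1⟩
    have nu_g : ∀ a, nu (g a) = a := by
      refine fun a => (hnu (g a)).unique ⟨?_, fun b hb => hb ?_⟩
      · rintro _ ⟨z, hz, rfl⟩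
        exact (mem_lowerGraph.1 hz).1
      · exact ⟨(f a, a), mem_lowerGraph.2 ⟨le_rfl, rfl⟩, rfl⟩
    refine ⟨fun a => I (g a), fun a => ⟨g a, rfl⟩, fun a b hab => (I_le _ _).2 fun z hz => ?_,
      fun a => (I_norm _).trans (nu_g a), fun a b hab => ?_⟩
    · exact mem_lowerGraph.2 ⟨(mem_lowerGraph.1 hz).1.trans hab, (mem_lowerGraph.1 hz).2⟩
    · have hmax : I (g a) ∈ nonMaxPart (Set.range I) :=
        ⟨⟨g a, rfl⟩, by rw [I_norm, nu_g]; exact hab.not_isMax⟩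
      refine ⟨hmax, fun w hw => (hI _ _).2 fun z hz => ?_⟩
      obtain ⟨hwS, hwb⟩ := hw
      have hzb := mem_lowerGraph.1 (((hI _ _).1 hwb) hz)
      -- A pair of `w` lies on the graph of `f` below `b` and in the merged `S` at `a`, so freeness
      -- puts it below `a`.
      refine mem_lowerGraph.2 ⟨hf a b z.2 hab.le hzb.1 ?_, hzb.2⟩
      have h : ∃ hz : BddAbove (Prod.snd '' (lowerGraph hA f a : Set (L × A))),
          I ⟨lowerGraph hA f a, hz⟩ ∈ nonMaxPart (Set.range I) := ⟨(g a).2, hmax⟩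
      rw [dif_pos h, ← hzb.2]
      exact Finset.mem_biUnion.2 ⟨w, hwS, hz⟩

end LabelledSets

end CritPoint

/-! ### The corollary -/

theorem corollaryC {P : Type u} [SemilatticeSup P] [OrderBot P]
    (m : ℕ) (hm : 1 < m) (hP : Nonempty (P ↪o CritPoint.BLeTwo m))
    (X : Set P) (R : X → Type v) (hR : ∀ x, Finite (R x))
    (α : ℕ∞) (hα : 0 < α) :
    ∃ (U : Type (max u v)) (_ : PartialOrder U)
      (nu : U → CritPoint.TreeLex X R α) (B : Set (CritPoint.SharpIdeal nu)),
      CritPoint.IsAlephZeroLifter nu B ∧ Cardinal.mk U = Cardinal.aleph 2 := by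
  obtain ⟨e⟩ := hP
  have : Finite P := Finite.of_injective e e.injective
  let κ : Type (max u v) := (Cardinal.aleph 2).out
  have hκ : Cardinal.mk κ = Cardinal.aleph 2 := Cardinal.mk_out _
  have : Infinite κ := Cardinal.infinite_iff.2 (hκ ▸ Cardinal.aleph0_le_aleph 2)
  have : Nonempty (CritPoint.TreeLex X R α) := (CritPoint.TreeLex.exists_isBot hα).nonempty
  obtain ⟨nu, B, hB⟩ := CritPoint.exists_isAlephZeroLifter (L := Finset κ)
    (CritPoint.TreeLex.finite_Iic (X := X) (R := R) (α := α))
    (fun Z hZ hb => CritPoint.TreeLex.exists_isLUB_of_bddAbove hα hZ hb)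
    (CritPoint.TreeLex.exists_free_labelling hκ.ge e)
  refine ⟨_, inferInstance, nu, B, hB, ?_⟩
  rw [CritPoint.mk_boundedFinset, Cardinal.mk_finset_of_infinite, hκ, Cardinal.lift_aleph]
  simp
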